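/- All graphs are finite, simple and undirected. For integers $k,g\ge 3$, a $(k,g)$-graph is a connected $k$-regular graph of girth exactly $g$ (the girth is the length of a shortest cycle), and the $(k,g)$-spectrum is the set of all orders (numbers of vertices) of $(k,g)$-graphs. Let $n(k,g)$ be the smallest order of a $(k,g)$-graph. Let $N(k,g)$ be the smallest $N$ such that a $(k,g)$-graph of order $n$ exists for all $n\ge N$ (if $k$ is odd, $N$ is required to be even and only even $n$ are considered). Let $C_n(1,3)$ be the circulant graph with vertex set $\mathbb{Z}/n\mathbb{Z}$ in which distinct $i$ and $j$ are adjacent if and only if $i-j\in\{1,-1,3,-3\}$ modulo $n$. Then the following hold. 1. The $(4,3)$-spectrum is $\{n\in\mathbb{N} : n\ge 5\}$. In particular $n(4,3)=5$, which is the order of the $(4,3)$-graph $K_5$. 2. The $(4,4)$-spectrum is $\{8\}\cup\{n\in\mathbb{N} : n\ge 10\}$. In particular there is no $(4,4)$-graph of order $9$, $n(4,4)=8$ and $N(4,4)=10$. Moreover, for every $n$ in the $(4,4)$-spectrum the circulant graph $C_n(1,3)$ is a $(4,4)$-graph, while $C_9(1,3)$ has girth $3$. 3. The $(4,5)$-spectrum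 is $\{n\in\mathbb{N} : n\ge 19\}$, so $N(4,5)=n(4,5)=19$. -/

import Mathlib

/-- A `(k, g)`-graph: a finite connected `k`-regular simple graph of girth exactly `g`. The girth is
the length of a shortest cycle (`⊤` for an acyclic graph). -/
structure IsKGGraph {V : Type*} (k g : ℕ) (G : SimpleGraph V) : Prop where
  finite : Finite V
  connected : G.Connected
  regular : ∃ _ : G.LocallyFinite, G.IsRegularOfDegree k
  egirth_eq : G.egirth = (g : ℕ∞)

/-- The `(k, g)`-spectrum: the set of all orders of `(k, g)`-graphs. -/
def kgSpectrum (k g : ℕ) : Set ℕ :=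
  {n | ∃ G : SimpleGraph (Fin n), IsKGGraph k g G}

/-- `n(k, g)`: the smallest order of a `(k, g)`-graph, that is, the order of the `(k, g)`-cages. -/
noncomputable def cageOrder (k g : ℕ) : ℕ := sInf (kgSpectrum k g)

/-- `N(k, g)`: the smallest `N` such that a `(k, g)`-graph of order `n` exists for all `n ≥ N`. If
`k` is odd then only even orders occur: `N` is even and only even `n` are considered. -/
noncomputable def fullOrder (k g : ℕ) : ℕ :=
  sInf {N | (Odd k → Even N) ∧ ∀ n, N ≤ n → (Odd k → Even n) → n ∈ kgSpectrum k g}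

/-- The circulant graph `C_n(1, 3)`: its vertices are the integers modulo `n`, and distinct
vertices `i`, `j` are adjacent if and only if `i - j` is `1`, `-1`, `3` or `-3` modulo `n`. -/
def circulantOneThree (n : ℕ) : SimpleGraph (ZMod n) :=
  SimpleGraph.circulantGraph {1, -1, 3, -3}

/-! ### Girth bounds from short cycles. -/

namespace SimpleGraph

variable {V : Type*} {G : SimpleGraph V}

/-! Each spectrum is squeezed between a lower bound and explicit graphs. The degree gives order at
least 5. Without triangles, adjacent vertices have disjoint neighborhoods, which gives 8, and a
count around the one leftover vertex excludes 9.

For girth 5, let A be the adjacency matrix, J the all-ones matrix and P = J - A² - A + 3I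
(`farMatrix`). The entries of P are nonnegative and its rows sum to n - 17, so n ≥ 17. Moreover (2A
+ I)² = 4J - 4P + 13I. For n = 17, P = 0; for n = 18, P is the permutation matrix of a
fixed-point-free involution and commutes with A. Adding J to 2A + I, respectively multiplying it by
I - P, gives an integer matrix whose square is divisible by 13, respectively 17, while its trace 34,
respectively 18, is not. This contradicts `Matrix.dvd_trace_of_mul_self_eq_smul`.

Girths 3 and 4 are realized by the circulants C_n(1,2) and C_n(1,3). For girth 5, orders 19 to 33
have explicit chord lists. Order 2m with m ≥ 17 is a bicirculant graph whose walks of length 4 shift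
by at most 16, so its girth is a finite check over ℤ. Order 2m + 1 comes from inserting a vertex
into two distant edges of it (`isKGGraph_insertTable`). -/

theorem egirth_le_three {a b c : V} (hab : G.Adj a b) (hbc : G.Adj b c) (hca : G.Adj c a) :
    G.egirth ≤ 3 := by
  have hw : (Walk.cons hab (.cons hbc (.cons hca .nil))).IsCycle := by
    have := hab.ne; have := hbc.ne; have := hca.ne
    simp [Walk.isCycle_def, Walk.isTrail_def]
    grind
  simpa using egirth_le_length hw

theorem egirth_le_four {a b c d : V} (hab : G.Adj a b) (hbc : G.Adj b c) (hcd : G.Adj c d)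
    (hda : G.Adj d a) (hac : a ≠ c) (hbd : b ≠ d) : G.egirth ≤ 4 := by
  have hw : (Walk.cons hab (.cons hbc (.cons hcd (.cons hda .nil)))).IsCycle := by
    have := hab.ne; have := hbc.ne; have := hcd.ne; have := hda.ne
    simp [Walk.isCycle_def, Walk.isTrail_def]
    grind
  simpa using egirth_le_length hw

theorem egirth_le_five {p : Fin 5 → V} (hp : Function.Injective p)
    (hadj : ∀ i, G.Adj (p i) (p (i + 1))) : G.egirth ≤ 5 := by
  have hw : (Walk.cons (hadj 0) (.cons (hadj 1) (.cons (hadj 2) (.cons (hadj 3)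
      (.cons (hadj 4) .nil))))).IsCycle := by
    simp [Walk.isCycle_def, Walk.isTrail_def, hp.eq_iff]
  simpa using egirth_le_length hw

theorem four_le_egirth (h3 : ∀ a b c, G.Adj a b → G.Adj b c → ¬ G.Adj c a) : 4 ≤ G.egirth := by
  rw [le_egirth]
  intro a w hw
  have h := hw.three_le_length
  norm_cast
  by_contra hlt
  match w, hw with
  | .cons hab (.cons hbc (.cons hca .nil)), _ => exact h3 _ _ _ hab hbc hca
  | .nil, _ => simp at h
  | .cons _ .nil, _ => simp at h
  | .cons _ (.cons _ .nil), _ => simp at h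
  | .cons _ (.cons _ (.cons _ (.cons _ _))), _ => simp at hlt

theorem five_le_egirth (h3 : ∀ a b c, G.Adj a b → G.Adj b c → ¬ G.Adj c a)
    (h4 : ∀ a b c d, G.Adj a b → G.Adj b c → G.Adj c d → G.Adj d a → a ≠ c → b = d) :
    5 ≤ G.egirth := by
  rw [le_egirth]
  intro a w hw
  have h := hw.three_le_length
  norm_cast
  by_contra hlt
  match w, hw with
  | .cons hab (.cons hbc (.cons hca .nil)), _ => exact h3 _ _ _ hab hbc hca
  | .cons hab (.cons hbc (.cons hcd (.cons hda .nil))), hw =>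
    have := h4 _ _ _ _ hab hbc hcd hda
    simp [Walk.isCycle_def, Walk.isTrail_def] at hw
    grind
  | .nil, _ => simp at h
  | .cons _ .nil, _ => simp at h
  | .cons _ (.cons _ .nil), _ => simp at h
  | .cons _ (.cons _ (.cons _ (.cons _ (.cons _ _)))), _ => simp at hlt

theorem not_adj_of_four_le_egirth (h : 4 ≤ G.egirth) {a b c : V} (hab : G.Adj a b)
    (hbc : G.Adj b c) : ¬ G.Adj c a := fun hca ↦ by
  have := h.trans (egirth_le_three hab hbc hca)
  norm_num at this

theorem eq_of_five_le_egirth (h : 5 ≤ G.egirth) {a b c d : V} (hab : G.Adj a b) (hbc : G.Adj b c)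
    (hcd : G.Adj c d) (hda : G.Adj d a) (hac : a ≠ c) : b = d := by
  by_contra hbd
  have := h.trans (egirth_le_four hab hbc hcd hda hac hbd)
  norm_num at this

end SimpleGraph

/-! ### Regularity and invariance under isomorphism. -/

section Spectrum

variable {V W : Type*} {k g n : ℕ}

theorem IsKGGraph.degree_eq {G : SimpleGraph V} (h : IsKGGraph k g G) [G.LocallyFinite] (v : V) :
    G.degree v = k := by
  obtain ⟨hf, hr⟩ := h.regular
  rw [← hr v]
  congr!

theorem IsKGGraph.map_iso {G : SimpleGraph V} {H : SimpleGraph W} (h : IsKGGraph k g G)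
    (e : G ≃g H) : IsKGGraph k g H where
  finite := by
    have := h.finite
    exact .of_equiv V e.toEquiv
  connected := e.connected_iff.1 h.connected
  regular := by
    classical
    have := h.finite
    have := Fintype.ofFinite V
    have : Finite W := .of_equiv V e.toEquiv
    have := Fintype.ofFinite W
    refine ⟨fun _ ↦ inferInstance, fun w ↦ ?_⟩
    rw [← e.apply_symm_apply w, e.degree_eq]
    exact h.degree_eq _
  egirth_eq := by rw [← h.egirth_eq, e.egirth_eq]

theorem IsKGGraph.card_mem_kgSpectrum {G : SimpleGraph V} (h : IsKGGraph k g G)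
    (hn : Nat.card V = n) : n ∈ kgSpectrum k g := by
  have := h.finite
  exact ⟨_, h.map_iso (SimpleGraph.Iso.map (Finite.equivFinOfCardEq hn) G)⟩

end Spectrum

/-! ### Graphs given by neighbor tables. -/

/-- The graph in which the neighbors of `v` are the entries `nb v x`. -/
def tableGraph {V : Type*} {k : ℕ} (nb : V → Fin k → V) : SimpleGraph V :=
  SimpleGraph.fromRel fun u v ↦ ∃ x, nb u x = v

/-- `nb v` lists without repetition the neighbors of `v` in a simple graph. -/
structure IsNeighborTable {V : Type*} {k : ℕ} (nb : V → Fin k → V) : Prop where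
  ne : ∀ v x, nb v x ≠ v
  symm : ∀ v x, ∃ y, nb (nb v x) y = v
  inj : ∀ v, Function.Injective (nb v)

namespace IsNeighborTable

variable {V : Type*} {k g : ℕ} {nb : V → Fin k → V}

theorem adj (h : IsNeighborTable nb) {u v : V} : (tableGraph nb).Adj u v ↔ ∃ x, nb u x = v := by
  simp only [tableGraph, SimpleGraph.fromRel_adj]
  constructor
  · rintro ⟨-, h' | ⟨x, rfl⟩⟩
    · exact h'
    · exact h.symm v x
  · rintro ⟨x, rfl⟩
    exact ⟨(h.ne u x).symm, .inl ⟨x, rfl⟩⟩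

theorem isKGGraph (h : IsNeighborTable nb) [Finite V] (hc : (tableGraph nb).Connected)
    (hg : (tableGraph nb).egirth = g) : IsKGGraph k g (tableGraph nb) where
  finite := ‹_›
  connected := hc
  regular := by
    classical
    have := Fintype.ofFinite V
    refine ⟨fun _ ↦ inferInstance, fun v ↦ ?_⟩
    have : (tableGraph nb).neighborFinset v = Finset.univ.image (nb v) := by
      ext u
      simp [h.adj]
    rw [← SimpleGraph.card_neighborFinset_eq_degree, this,
      Finset.card_image_of_injective _ (h.inj v)]
    simp
  egirth_eq := hg

theorem four_le_egirth (h : IsNeighborTable nb) (h3 : ∀ v x y z, nb (nb (nb v x) y) z ≠ v) :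
    4 ≤ (tableGraph nb).egirth := by
  refine SimpleGraph.four_le_egirth fun a b c hab hbc hca ↦ ?_
  obtain ⟨x, rfl⟩ := h.adj.1 hab
  obtain ⟨y, rfl⟩ := h.adj.1 hbc
  obtain ⟨z, hz⟩ := h.adj.1 hca
  exact h3 a x y z hz

/-- A 4-cycle amounts to two paths of length 2 from `v` to one end other than `v` with different
first steps. In terms of indices this is a decidable condition. -/
theorem five_le_egirth (h : IsNeighborTable nb) (h3 : ∀ v x y z, nb (nb (nb v x) y) z ≠ v)
    (h4 : ∀ v x y z w, nb (nb v x) y = nb (nb v z) w → nb (nb v x) y ≠ v → x = z) :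
    5 ≤ (tableGraph nb).egirth := by
  refine SimpleGraph.five_le_egirth (fun a b c hab hbc hca ↦ ?_)
    fun a b c d hab hbc hcd hda hac ↦ ?_
  · obtain ⟨x, rfl⟩ := h.adj.1 hab
    obtain ⟨y, rfl⟩ := h.adj.1 hbc
    obtain ⟨z, hz⟩ := h.adj.1 hca
    exact h3 a x y z hz
  · obtain ⟨x, rfl⟩ := h.adj.1 hab
    obtain ⟨y, rfl⟩ := h.adj.1 hbc
    obtain ⟨z, rfl⟩ := h.adj.1 hda.symm
    obtain ⟨w, hw⟩ := h.adj.1 hcd.symm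
    rw [h4 a x y z w hw.symm hac.symm]

end IsNeighborTable

/-- A graph on the integers modulo `n` in which consecutive integers are adjacent is connected. -/
theorem SimpleGraph.connected_of_adj_add_one {n : ℕ} {G : SimpleGraph (ZMod n)} [NeZero n]
    (h : ∀ i, G.Adj i (i + 1)) : G.Connected where
  preconnected := by
    have h0 (m : ℕ) : G.Reachable 0 m := by
      induction m with
      | zero => simp
      | succ m ih => exact ih.trans (by simpa using (h m).reachable)
    intro i j
    have hi := h0 i.val
    have hj := h0 j.val
    rw [ZMod.natCast_zmod_val] at hi hj
    exact hi.symm.trans hj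
  nonempty := ⟨0⟩

/-- Turns congruences between small jumps into integer identities independent of `n`, which `decide`
can settle for all moduli at once. -/
theorem ZMod.intCast_eq_zero_iff_of_abs_lt {n : ℕ} {z : ℤ} (h : |z| < n) :
    (z : ZMod n) = 0 ↔ z = 0 := by
  rw [ZMod.intCast_zmod_eq_zero_iff_dvd]
  exact ⟨fun hd ↦ Int.eq_zero_of_abs_lt_dvd hd h, fun hz ↦ hz ▸ dvd_zero _⟩

/-! ### Lower bounds on the order. -/

section LowerBounds

open Finset Matrix SimpleGraph

variable {k : ℕ} {V : Type*} [Fintype V] {G : SimpleGraph V}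

theorem IsKGGraph.lt_card {g : ℕ} (h : IsKGGraph k g G) : k < Fintype.card V := by
  classical
  have := h.connected.nonempty
  rw [← h.degree_eq (Classical.arbitrary V)]
  exact G.degree_lt_card_verts _

variable [DecidableEq V] [DecidableRel G.Adj]

omit [DecidableEq V] in
/-- In a triangle-free graph the neighborhoods of adjacent vertices are disjoint. -/
theorem SimpleGraph.disjoint_neighborFinset_of_adj
    (h3 : ∀ a b c, G.Adj a b → G.Adj b c → ¬ G.Adj c a) {u v : V} (huv : G.Adj u v) :
    Disjoint (G.neighborFinset u) (G.neighborFinset v) := by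
  rw [Finset.disjoint_left]
  intro w hu hv
  rw [mem_neighborFinset] at hu hv
  exact h3 u v w huv hv hu.symm

theorem SimpleGraph.two_mul_le_card_of_triangleFree [Nonempty V] (hk : k ≠ 0)
    (hd : ∀ v, G.degree v = k)
    (h3 : ∀ a b c, G.Adj a b → G.Adj b c → ¬ G.Adj c a) : 2 * k ≤ Fintype.card V := by
  have u := Classical.arbitrary V
  obtain ⟨v, huv⟩ := (G.degree_pos_iff_exists_adj u).1 (by rw [hd]; lia)
  rw [← card_univ]
  refine le_trans ?_ (card_le_card (subset_univ (G.neighborFinset u ∪ G.neighborFinset v)))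
  rw [card_union_of_disjoint (disjoint_neighborFinset_of_adj h3 huv)]
  simp [hd, two_mul]

/-- For an edge `u v`, exactly one vertex `w` lies outside N(u) ∪ N(v). The four neighbors of `w`
split between N(u) and N(v), with some on both sides, yet `few` allows at most one on each. -/
theorem SimpleGraph.card_ne_nine_of_triangleFree [Nonempty V] (hd : ∀ v, G.degree v = 4)
    (h3 : ∀ a b c, G.Adj a b → G.Adj b c → ¬ G.Adj c a) : Fintype.card V ≠ 9 := by
  intro hn
  have hN (x : V) : #(G.neighborFinset x) = 4 := by simp [hd]
  have u := Classical.arbitrary V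
  obtain ⟨v, huv⟩ := (G.degree_pos_iff_exists_adj u).1 (by rw [hd]; lia)
  have hdisj := disjoint_neighborFinset_of_adj h3 huv
  obtain ⟨w, hw⟩ : ∃ w, (G.neighborFinset u ∪ G.neighborFinset v)ᶜ = {w} := by
    rw [← card_eq_one, card_compl, card_union_of_disjoint hdisj, hN, hN, hn]
  have hcover (x : V) : G.Adj u x ∨ G.Adj v x ∨ x = w := by
    have : x ∈ (G.neighborFinset u ∪ G.neighborFinset v)ᶜ ↔ x = w := by simp [hw]
    simp only [mem_compl, mem_union, mem_neighborFinset] at this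
    tauto
  have hwuv : ¬ G.Adj u w ∧ ¬ G.Adj v w := by
    have : w ∈ (G.neighborFinset u ∪ G.neighborFinset v)ᶜ := by simp [hw]
    simpa using this
  -- The three neighbors of `p` other than `w` avoid N(a) and N(w), since there are no triangles, so
  -- they lie in N(b) and leave room there for at most one neighbor of `w`.
  have few {a b p : V} (hc : ∀ x, G.Adj a x ∨ G.Adj b x ∨ x = w) (hap : G.Adj a p)
      (hwp : G.Adj w p) : #(G.neighborFinset w ∩ G.neighborFinset b) ≤ 1 := by
    have hsub : (G.neighborFinset p).erase w ⊆ G.neighborFinset b \ G.neighborFinset w := by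
      intro x hx
      simp only [mem_erase, mem_neighborFinset, mem_sdiff] at hx ⊢
      have := h3 a p x hap hx.2
      have := h3 w p x hwp hx.2
      have := hc x
      grind [G.adj_comm]
    have h1 := card_le_card hsub
    rw [card_erase_of_mem (by simpa using hwp.symm), hN, card_sdiff, hN] at h1
    lia
  have hsum : #(G.neighborFinset w ∩ G.neighborFinset u) +
      #(G.neighborFinset w ∩ G.neighborFinset v) = 4 := by
    rw [← card_union_of_disjoint (hdisj.mono inter_subset_right inter_subset_right),
      ← inter_union_distrib_left, ← hN w]
    congr 1
    rw [inter_eq_left]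
    intro x hx
    rw [mem_neighborFinset] at hx
    have := hcover x
    have := hx.ne'
    grind [mem_neighborFinset]
  -- The vertex `b` is in N(a) but not in N(w).
  have hlt {a b : V} (hab : G.Adj a b) (hbw : ¬ G.Adj b w) :
      #(G.neighborFinset w ∩ G.neighborFinset a) < 4 := by
    rw [← hN a]
    refine card_lt_card ⟨inter_subset_right, fun h ↦ hbw ?_⟩
    have := h ((G.mem_neighborFinset a b).2 hab)
    simp only [mem_inter, mem_neighborFinset] at this
    exact this.1.symm
  have hu := hlt huv hwuv.2
  have hv := hlt huv.symm hwuv.1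
  obtain ⟨p, hp⟩ : (G.neighborFinset w ∩ G.neighborFinset u).Nonempty := by
    rw [← card_pos]; lia
  obtain ⟨q, hq⟩ : (G.neighborFinset w ∩ G.neighborFinset v).Nonempty := by
    rw [← card_pos]; lia
  simp only [mem_inter, mem_neighborFinset] at hp hq
  have := few hcover hp.2 hp.1
  have := few (fun x ↦ by have := hcover x; tauto) hq.2 hq.1
  lia

/-- A prime that divides the square of an integer matrix divides its trace. -/
theorem Matrix.dvd_trace_of_mul_self_eq_smul {p : ℕ} [Fact p.Prime] {M X : Matrix V V ℤ}
    (h : M * M = (p : ℤ) • X) : (p : ℤ) ∣ M.trace := by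
  have hnil : IsNilpotent (M.map (Int.castRingHom (ZMod p))) := by
    refine ⟨2, ?_⟩
    rw [sq, ← Matrix.map_mul, h]
    ext i j
    rw [Matrix.map_apply, Matrix.smul_apply]
    simp
  have := (isNilpotent_trace_of_isNilpotent hnil).eq_zero
  rw [← ZMod.intCast_zmod_eq_zero_iff_dvd, ← this]
  simp [Matrix.trace]

/-- The matrix of the pairs of vertices at distance at least three in a graph of girth five with
adjacency matrix `A` and vertex degree `k + 1`. -/
def farMatrix (G : SimpleGraph V) [DecidableRel G.Adj] (k : ℕ) : Matrix V V ℤ :=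
  Matrix.of (fun _ _ ↦ 1) - G.adjMatrix ℤ * G.adjMatrix ℤ - G.adjMatrix ℤ + (k : ℤ) • 1

theorem farMatrix_apply (u v : V) : farMatrix G k u v =
    1 - #(G.neighborFinset u ∩ G.neighborFinset v) - (if G.Adj u v then 1 else 0) +
      if u = v then (k : ℤ) else 0 := by
  have : (G.adjMatrix ℤ * G.adjMatrix ℤ) u v = #(G.neighborFinset u ∩ G.neighborFinset v) := by
    rw [adjMatrix_mul_apply]
    simp only [adjMatrix_apply, sum_boole]
    congr 2
    ext w
    simp [G.adj_comm]
  rw [farMatrix, Matrix.add_apply, Matrix.sub_apply, Matrix.sub_apply, this, Matrix.smul_apply,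
    one_apply]
  simp

variable (h3 : ∀ a b c, G.Adj a b → G.Adj b c → ¬ G.Adj c a)
  (h4 : ∀ a b c d, G.Adj a b → G.Adj b c → G.Adj c d → G.Adj d a → a ≠ c → b = d)
  (hd : ∀ v, G.degree v = k + 1)

include hd in
theorem farMatrix_apply_self (u : V) : farMatrix G k u u = 0 := by
  simp [farMatrix_apply, hd]

include h3 in
theorem farMatrix_apply_of_adj {u v : V} (huv : G.Adj u v) : farMatrix G k u v = 0 := by
  have := (disjoint_neighborFinset_of_adj h3 huv)
  rw [disjoint_iff_inter_eq_empty] at this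
  simp [farMatrix_apply, huv, huv.ne, this]

-- Two distinct nonadjacent vertices have at most one common neighbor, as there is no 4-cycle; their
-- entry is 1 minus that number.
include h3 h4 hd in
theorem farMatrix_nonneg (u v : V) : 0 ≤ farMatrix G k u v := by
  by_cases huv : u = v
  · rw [huv, farMatrix_apply_self hd]
  by_cases hadj : G.Adj u v
  · rw [farMatrix_apply_of_adj h3 hadj]
  have : #(G.neighborFinset u ∩ G.neighborFinset v) ≤ 1 := by
    rw [card_le_one]
    intro a ha b hb
    simp only [mem_inter, mem_neighborFinset] at ha hb
    exact h4 u a v b ha.1 ha.2.symm hb.2 hb.1.symm huv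
  rw [farMatrix_apply, if_neg hadj, if_neg huv]
  lia

theorem farMatrix_comm (u v : V) : farMatrix G k u v = farMatrix G k v u := by
  simp only [farMatrix_apply, inter_comm, G.adj_comm, eq_comm]

omit [DecidableEq V] in
include hd in
theorem adjMatrix_mul_ones : G.adjMatrix ℤ * Matrix.of (fun _ _ ↦ 1) =
    (k + 1 : ℤ) • Matrix.of (fun _ _ ↦ 1) := by
  ext u v
  simp [adjMatrix_mul_apply, hd]

omit [DecidableEq V] in
include hd in
theorem ones_mul_adjMatrix : Matrix.of (fun _ _ ↦ 1) * G.adjMatrix ℤ =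
    (k + 1 : ℤ) • Matrix.of (fun _ _ ↦ 1) := by
  ext u v
  simp [mul_adjMatrix_apply, hd]

omit [DecidableEq V] in
theorem ones_mul_ones : (Matrix.of (fun _ _ ↦ 1) : Matrix V V ℤ) * Matrix.of (fun _ _ ↦ 1) =
    (Fintype.card V : ℤ) • Matrix.of (fun _ _ ↦ 1) := by
  ext u v
  simp [mul_apply]

include hd in
theorem farMatrix_mul_ones : farMatrix G k * Matrix.of (fun _ _ ↦ 1) =
    (Fintype.card V - ((k + 1) ^ 2 + 1) : ℤ) • Matrix.of (fun _ _ ↦ 1) := by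
  rw [farMatrix, add_mul, sub_mul, sub_mul, ones_mul_ones, mul_assoc, adjMatrix_mul_ones hd,
    mul_smul_comm, adjMatrix_mul_ones hd, smul_mul_assoc, one_mul]
  module

include hd in
theorem sum_farMatrix (u : V) :
    ∑ v, farMatrix G k u v = Fintype.card V - ((k + 1) ^ 2 + 1) := by
  simpa [mul_apply] using congr_fun₂ (farMatrix_mul_ones hd) u u

include hd in
theorem farMatrix_comm_adjMatrix :
    farMatrix G k * G.adjMatrix ℤ = G.adjMatrix ℤ * farMatrix G k := by
  simp only [farMatrix, add_mul, sub_mul, mul_add, mul_sub, ones_mul_adjMatrix hd,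
    adjMatrix_mul_ones hd, mul_assoc, smul_mul_assoc, one_mul, mul_smul_comm, mul_one]

-- The Moore bound: a row of nonnegative entries has a nonnegative sum.
include h3 h4 hd in
theorem SimpleGraph.sq_add_one_le_card [Nonempty V] : (k + 1) ^ 2 + 1 ≤ Fintype.card V := by
  have u := Classical.arbitrary V
  have := sum_farMatrix hd u
  have := sum_nonneg fun v (_ : v ∈ univ) ↦ farMatrix_nonneg h3 h4 hd u v
  zify
  lia

include h3 h4 hd in
theorem farMatrix_eq_zero (hn : Fintype.card V = (k + 1) ^ 2 + 1) : farMatrix G k = 0 := by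
  ext u v
  have h := sum_farMatrix hd u
  rw [hn] at h
  push_cast at h
  rw [sub_self, sum_eq_zero_iff_of_nonneg fun v _ ↦ farMatrix_nonneg h3 h4 hd u v] at h
  exact h v (mem_univ v)

-- Nonnegative integer rows with sum 1 make a permutation matrix, and a symmetric one is an
-- involution.
include h3 h4 hd in
theorem farMatrix_mul_self (hn : Fintype.card V = (k + 1) ^ 2 + 2) :
    farMatrix G k * farMatrix G k = 1 := by
  have h0 := farMatrix_nonneg h3 h4 hd
  have hsum (u : V) : ∑ v, farMatrix G k u v = 1 := by
    rw [sum_farMatrix hd, hn]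
    push_cast
    ring
  ext u v
  rw [mul_apply]
  obtain rfl | huv := eq_or_ne u v
  · rw [one_apply_eq, ← hsum u]
    refine sum_congr rfl fun w _ ↦ ?_
    have := single_le_sum (fun v _ ↦ h0 u v) (mem_univ w)
    rw [hsum] at this
    rw [farMatrix_comm w]
    have := h0 u w
    obtain h | h : farMatrix G k u w = 0 ∨ farMatrix G k u w = 1 := by lia
    all_goals rw [h]; rfl
  · rw [one_apply_ne huv]
    refine sum_eq_zero fun w _ ↦ ?_
    have : farMatrix G k w u + farMatrix G k w v ≤ 1 := by
      rw [← hsum w, ← sum_pair huv]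
      exact sum_le_sum_of_subset_of_nonneg (subset_univ _) fun v _ _ ↦ h0 w v
    have h1 := h0 w u
    have h2 := h0 w v
    rw [farMatrix_comm u]
    obtain h | h : farMatrix G k w u = 0 ∨ farMatrix G k w v = 0 := by lia
    all_goals simp [h]

/-- The square of `2 A + 1`, where `A` is the adjacency matrix. -/
theorem two_mul_adjMatrix_add_one_mul_self :
    (2 * G.adjMatrix ℤ + 1) * (2 * G.adjMatrix ℤ + 1) =
      (4 : ℤ) • Matrix.of (fun _ _ ↦ 1) - (4 : ℤ) • farMatrix G k + (4 * k + 1 : ℤ) • 1 := by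
  have : (2 * G.adjMatrix ℤ + 1) * (2 * G.adjMatrix ℤ + 1) =
      (4 : ℤ) • (G.adjMatrix ℤ * G.adjMatrix ℤ) + (4 : ℤ) • G.adjMatrix ℤ + 1 := by
    noncomm_ring
  rw [this, farMatrix]
  module

/-- With M = 2A + I + J, the relations AJ = 4J and J² = 17J give M² = 39J + 13I = 13(3J + I), while
tr M = 34. -/
theorem SimpleGraph.card_ne_seventeen (hd : ∀ v, G.degree v = 4)
    (h3 : ∀ a b c, G.Adj a b → G.Adj b c → ¬ G.Adj c a)
    (h4 : ∀ a b c d, G.Adj a b → G.Adj b c → G.Adj c d → G.Adj d a → a ≠ c → b = d) :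
    Fintype.card V ≠ 17 := by
  intro hn
  have hsq := two_mul_adjMatrix_add_one_mul_self (G := G) (k := 3)
  rw [farMatrix_eq_zero h3 h4 (k := 3) hd hn] at hsq
  have hAJ := adjMatrix_mul_ones (k := 3) hd
  have hJA := ones_mul_adjMatrix (k := 3) hd
  have hJJ := ones_mul_ones (V := V)
  rw [hn] at hJJ
  have htr : (2 * G.adjMatrix ℤ + 1 + Matrix.of (fun _ _ ↦ 1)).trace = 34 := by
    rw [trace_add, trace_add, two_mul, trace_add, trace_adjMatrix, trace_one, hn]
    simp [Matrix.trace, hn]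
  have : Fact (Nat.Prime 13) := ⟨by norm_num⟩
  have hdvd := dvd_trace_of_mul_self_eq_smul (p := 13)
    (M := 2 * G.adjMatrix ℤ + 1 + Matrix.of (fun _ _ ↦ 1))
    (X := (3 : ℤ) • Matrix.of (fun _ _ ↦ 1) + 1) (by
      rw [mul_add, add_mul _ _ (2 * G.adjMatrix ℤ + 1), hsq, mul_add, mul_one, add_mul, add_mul,
        one_mul, hJJ, mul_assoc, hAJ, two_mul (G.adjMatrix ℤ), mul_add, hJA, two_mul]
      module)
  rw [htr] at hdvd
  norm_num at hdvd

/-- Since JP = J, the factor I - P annihilates J, and M = (2A + I)(I - P) satisfies M² = 34(I - P).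
Both P and AP have trace 0, because P vanishes on the diagonal and on edges; hence tr M = 18. -/
theorem SimpleGraph.card_ne_eighteen (hd : ∀ v, G.degree v = 4)
    (h3 : ∀ a b c, G.Adj a b → G.Adj b c → ¬ G.Adj c a)
    (h4 : ∀ a b c d, G.Adj a b → G.Adj b c → G.Adj c d → G.Adj d a → a ≠ c → b = d) :
    Fintype.card V ≠ 18 := by
  intro hn
  have hsq := two_mul_adjMatrix_add_one_mul_self (G := G) (k := 3)
  have hPP := farMatrix_mul_self h3 h4 (k := 3) hd hn
  have hPA := farMatrix_comm_adjMatrix (k := 3) hd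
  have hJP : Matrix.of (fun _ _ ↦ 1) * farMatrix G 3 = Matrix.of (fun _ _ ↦ 1) := by
    ext u v
    simp_rw [mul_apply, farMatrix_comm _ v, Matrix.of_apply, one_mul]
    rw [sum_farMatrix hd, hn]
    norm_num
  have htrP : (farMatrix G 3).trace = 0 := sum_eq_zero fun u _ ↦ farMatrix_apply_self hd u
  have htrAP : (G.adjMatrix ℤ * farMatrix G 3).trace = 0 := by
    refine sum_eq_zero fun u _ ↦ ?_
    rw [Matrix.diag_apply, adjMatrix_mul_apply]
    refine sum_eq_zero fun v hv ↦ farMatrix_apply_of_adj h3 ?_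
    rw [mem_neighborFinset] at hv
    exact hv.symm
  have htr : ((2 * G.adjMatrix ℤ + 1) * (1 - farMatrix G 3)).trace = 18 := by
    rw [mul_sub, mul_one, two_mul, add_mul, add_mul, one_mul, trace_sub, trace_add, trace_add,
      trace_add, trace_add, trace_adjMatrix, trace_one, htrAP, htrP, hn]
    norm_num
  have hcomm : Commute (1 - farMatrix G 3) (2 * G.adjMatrix ℤ + 1) := by
    have h : Commute (farMatrix G 3) (G.adjMatrix ℤ) := hPA
    refine (Commute.one_left _).sub_left (Commute.add_right ?_ (Commute.one_right _))
    rw [two_mul]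
    exact h.add_right h
  have hQ : (1 - farMatrix G 3) * (1 - farMatrix G 3) = (2 : ℤ) • (1 - farMatrix G 3) := by
    rw [sub_mul, mul_sub, mul_sub, hPP, one_mul, one_mul, mul_one]
    module
  have : Fact (Nat.Prime 17) := ⟨by norm_num⟩
  have hdvd := dvd_trace_of_mul_self_eq_smul (p := 17)
    (M := (2 * G.adjMatrix ℤ + 1) * (1 - farMatrix G 3))
    (X := (2 : ℤ) • (1 - farMatrix G 3)) (by
      rw [hcomm.mul_mul_mul_comm, hsq, hQ, mul_smul_comm, mul_sub, mul_one, add_mul, sub_mul,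
        smul_mul_assoc, smul_mul_assoc, smul_mul_assoc, hJP, hPP, one_mul]
      module)
  rw [htr] at hdvd
  norm_num at hdvd

end LowerBounds

open SimpleGraph in
theorem five_le_of_mem_kgSpectrum_four {n g : ℕ} (h : n ∈ kgSpectrum 4 g) : 5 ≤ n := by
  obtain ⟨G, hG⟩ := h
  have := hG.lt_card
  rwa [Fintype.card_fin] at this

open SimpleGraph in
theorem eight_le_and_ne_nine_of_mem_kgSpectrum_four_four {n : ℕ} (h : n ∈ kgSpectrum 4 4) :
    8 ≤ n ∧ n ≠ 9 := by
  classical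
  obtain ⟨G, hG⟩ := h
  have := hG.connected.nonempty
  have h3 (a b c) := not_adj_of_four_le_egirth hG.egirth_eq.ge (a := a) (b := b) (c := c)
  constructor
  · simpa using two_mul_le_card_of_triangleFree four_ne_zero hG.degree_eq h3
  · simpa using card_ne_nine_of_triangleFree hG.degree_eq h3

open SimpleGraph in
theorem nineteen_le_of_mem_kgSpectrum_four_five {n : ℕ} (h : n ∈ kgSpectrum 4 5) : 19 ≤ n := by
  classical
  obtain ⟨G, hG⟩ := h
  have := hG.connected.nonempty
  have h3 (a b c) := not_adj_of_four_le_egirth (le_trans (by norm_num) hG.egirth_eq.ge)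
    (a := a) (b := b) (c := c)
  have h4 (a b c d) := eq_of_five_le_egirth hG.egirth_eq.ge (a := a) (b := b) (c := c) (d := d)
  have h1 := sq_add_one_le_card h3 h4 (k := 3) hG.degree_eq
  have h2 := card_ne_seventeen hG.degree_eq h3 h4
  have h5 := card_ne_eighteen hG.degree_eq h3 h4
  rw [Fintype.card_fin] at h1 h2 h5
  lia

/-! ### Circulant graphs for girths 3 and 4. -/

section Circulant

variable {n : ℕ}

/-- The neighbors of `i` are the sums `i + c x`. -/
def circulantTable (n : ℕ) (c : Fin 4 → ℤ) (i : ZMod n) (x : Fin 4) : ZMod n := i + c x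

theorem isNeighborTable_circulantTable {c : Fin 4 → ℤ} (h0 : ∀ x, |c x| < n ∧ c x ≠ 0)
    (hneg : ∀ x, ∃ y, c y = -c x) (hsub : ∀ x y, |c x - c y| < n ∧ (c x - c y = 0 → x = y)) :
    IsNeighborTable (circulantTable n c) where
  ne i x h := by
    rw [circulantTable, add_eq_left, ZMod.intCast_eq_zero_iff_of_abs_lt (h0 x).1] at h
    exact (h0 x).2 h
  symm i x := by
    obtain ⟨y, hy⟩ := hneg x
    exact ⟨y, by simp [circulantTable, hy]⟩
  inj i x y h := by
    rw [circulantTable, circulantTable, add_right_inj, ← sub_eq_zero, ← Int.cast_sub,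
      ZMod.intCast_eq_zero_iff_of_abs_lt (hsub x y).1] at h
    exact (hsub x y).2 h

/-- The graph C_n(1,2) contains the triangle 0, 1, 2; its jumps differ by at most 4, so they stay
distinct modulo `n`. -/
theorem mem_kgSpectrum_four_three (hn : 5 ≤ n) : n ∈ kgSpectrum 4 3 := by
  have : NeZero n := ⟨by lia⟩
  have ht : IsNeighborTable (circulantTable n ![1, -1, 2, -2]) := by
    refine isNeighborTable_circulantTable (fun x ↦ ?_) (by decide) fun x y ↦ ?_
    · have : ∀ x, |(![1, -1, 2, -2] : Fin 4 → ℤ) x| < 5 ∧ ![1, -1, 2, -2] x ≠ 0 := by decide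
      exact ⟨by have := (this x).1; lia, (this x).2⟩
    · have : ∀ x y, |(![1, -1, 2, -2] : Fin 4 → ℤ) x - ![1, -1, 2, -2] y| < 5 ∧
        (![1, -1, 2, -2] x - ![1, -1, 2, -2] y = 0 → x = y) := by decide
      exact ⟨by have := (this x y).1; lia, (this x y).2⟩
  refine (ht.isKGGraph (SimpleGraph.connected_of_adj_add_one fun i ↦ ht.adj.2
    ⟨0, by simp [circulantTable]⟩) (le_antisymm ?_ SimpleGraph.three_le_egirth)).card_mem_kgSpectrum
    (Nat.card_zmod n)
  refine SimpleGraph.egirth_le_three (a := 0) (b := 1) (c := 2) (ht.adj.2 ⟨0, ?_⟩)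
    (ht.adj.2 ⟨0, ?_⟩) (ht.adj.2 ⟨3, ?_⟩)
  all_goals simp [circulantTable, one_add_one_eq_two]

theorem circulantOneThree_eq_tableGraph (n : ℕ) :
    circulantOneThree n = tableGraph (circulantTable n ![1, -1, 3, -3]) := by
  ext u v
  simp only [circulantOneThree, SimpleGraph.circulantGraph_adj, tableGraph,
    SimpleGraph.fromRel_adj, circulantTable, Fin.exists_fin_succ]
  simp
  grind

/-- A sum of three jumps is odd and at most 9 in absolute value, so it is neither 0 modulo 8 nor 0
modulo any n ≥ 10. Modulo 9, however, 3 + 3 + 3 vanishes. A 4-cycle is 0, 1, 4, 3. -/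
theorem isKGGraph_circulantOneThree (hn : 8 ≤ n) (h9 : n ≠ 9) :
    IsKGGraph 4 4 (circulantOneThree n) := by
  have : NeZero n := ⟨by lia⟩
  rw [circulantOneThree_eq_tableGraph]
  have ht : IsNeighborTable (circulantTable n ![1, -1, 3, -3]) := by
    refine isNeighborTable_circulantTable (fun x ↦ ?_) (by decide) fun x y ↦ ?_
    · have : ∀ x, |(![1, -1, 3, -3] : Fin 4 → ℤ) x| < 8 ∧ ![1, -1, 3, -3] x ≠ 0 := by decide
      exact ⟨by have := (this x).1; lia, (this x).2⟩
    · have : ∀ x y, |(![1, -1, 3, -3] : Fin 4 → ℤ) x - ![1, -1, 3, -3] y| < 8 ∧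
        (![1, -1, 3, -3] x - ![1, -1, 3, -3] y = 0 → x = y) := by decide
      exact ⟨by have := (this x y).1; lia, (this x y).2⟩
  have hadj (i j : ZMod n) (h : j = i + 1 ∨ j = i + 3) :
      (tableGraph (circulantTable n ![1, -1, 3, -3])).Adj i j := by
    obtain rfl | rfl := h
    · exact ht.adj.2 ⟨0, by simp [circulantTable]⟩
    · exact ht.adj.2 ⟨2, by simp [circulantTable]⟩
  refine ht.isKGGraph (SimpleGraph.connected_of_adj_add_one fun i ↦ hadj _ _ (.inl rfl))
    (le_antisymm ?_ (ht.four_le_egirth fun i x y z h ↦ ?_))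
  · have hne {z : ℤ} (hz : |z| < 8) (hz0 : z ≠ 0) : (z : ZMod n) ≠ 0 := fun h ↦
      hz0 ((ZMod.intCast_eq_zero_iff_of_abs_lt (by lia)).1 h)
    refine SimpleGraph.egirth_le_four (a := 0) (b := 1) (c := 4) (d := 3) (hadj _ _ ?_)
      (hadj _ _ ?_) (hadj _ _ ?_).symm (hadj _ _ ?_).symm (fun h ↦ ?_) fun h ↦ ?_
    · simp
    · norm_num
    · norm_num
    · simp
    · exact hne (z := 4) (by norm_num) (by norm_num) (by exact_mod_cast h.symm)
    · refine hne (z := 2) (by norm_num) (by norm_num) ?_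
      push_cast
      linear_combination -h
  · have key : ∀ x y z, |(![1, -1, 3, -3] : Fin 4 → ℤ) x + ![1, -1, 3, -3] y +
        ![1, -1, 3, -3] z| < 10 ∧ ¬ (8 : ℤ) ∣ ![1, -1, 3, -3] x + ![1, -1, 3, -3] y +
        ![1, -1, 3, -3] z ∧ (![1, -1, 3, -3] x + ![1, -1, 3, -3] y +
        ![1, -1, 3, -3] z : ℤ) ≠ 0 := by decide
    obtain ⟨h1, h2, h3⟩ := key x y z
    simp only [circulantTable, add_assoc, add_eq_left] at h
    norm_cast at h
    rw [← add_assoc, ZMod.intCast_zmod_eq_zero_iff_dvd] at h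
    obtain rfl | h10 : n = 8 ∨ 10 ≤ n := by lia
    · exact h2 h
    · exact h3 (Int.eq_zero_of_abs_lt_dvd h (by lia))

theorem egirth_circulantOneThree_nine : (circulantOneThree 9).egirth = 3 := by
  refine le_antisymm ?_ SimpleGraph.three_le_egirth
  refine SimpleGraph.egirth_le_three (a := 0) (b := 3) (c := 6) ?_ ?_ ?_ <;>
  · rw [circulantOneThree_eq_tableGraph, tableGraph, SimpleGraph.fromRel_adj]
    decide

end Circulant

/-! ### Girth 5, orders 19 to 33. -/

/-- The table of a graph on `Fin n` that contains the cycle `0, 1, …, n - 1` and in which the two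
other neighbors of `i` are the entries `2 i` and `2 i + 1` of the list `L`. -/
def chordTable (n : ℕ) [NeZero n] (L : List ℕ) (i : Fin n) (x : Fin 4) : Fin n :=
  ![i + 1, i - 1, Fin.ofNat n (L.getD (2 * i) 0), Fin.ofNat n (L.getD (2 * i + 1) 0)] x

/-- The finitely many equalities and inequalities between vertices which show that the graph of
`chordTable n L` has girth five. -/
def IsGirthFiveChordList (n : ℕ) [NeZero n] (L : List ℕ) : Prop :=
  (∀ v x, chordTable n L v x ≠ v) ∧
  (∀ v x, ∃ y, chordTable n L (chordTable n L v x) y = v) ∧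
  (∀ v x y, chordTable n L v x = chordTable n L v y → x = y) ∧
  (∀ v x y z, chordTable n L (chordTable n L (chordTable n L v x) y) z ≠ v) ∧
  (∀ v x y z w, chordTable n L (chordTable n L v x) y = chordTable n L (chordTable n L v z) w →
    chordTable n L (chordTable n L v x) y ≠ v → x = z) ∧
  ∀ i : Fin 5, ∃ x, chordTable n L (Fin.ofNat n i) x = Fin.ofNat n (i + 1 : Fin 5)

instance (n : ℕ) [NeZero n] (L : List ℕ) : Decidable (IsGirthFiveChordList n L) := by
  unfold IsGirthFiveChordList
  infer_instance

theorem IsGirthFiveChordList.mem_kgSpectrum {n : ℕ} [NeZero n] {L : List ℕ}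
    (h : IsGirthFiveChordList n L) (hn : 5 ≤ n) : n ∈ kgSpectrum 4 5 := by
  obtain ⟨hne, hsymm, hinj, h3, h4, h5⟩ := h
  have ht : IsNeighborTable (chordTable n L) := ⟨hne, hsymm, hinj⟩
  refine (ht.isKGGraph ?_ (le_antisymm ?_ (ht.five_le_egirth h3 h4))).card_mem_kgSpectrum
    (Nat.card_fin n)
  -- For a successor, `ZMod (m + 1)` unfolds to `Fin (m + 1)`.
  · obtain ⟨m, rfl⟩ := Nat.exists_eq_add_of_le' (NeZero.pos n)
    exact SimpleGraph.connected_of_adj_add_one (n := m + 1) fun i ↦ ht.adj.2 ⟨0, rfl⟩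
  · refine SimpleGraph.egirth_le_five (p := fun i : Fin 5 ↦ Fin.ofNat n i) (fun i j h ↦ ?_)
      fun i ↦ ht.adj.2 (h5 i)
    simp only [Fin.ext_iff, Fin.val_ofNat] at h
    rw [Nat.mod_eq_of_lt (by lia), Nat.mod_eq_of_lt (by lia)] at h
    exact Fin.ext h

set_option maxHeartbeats 1000000 in
theorem mem_kgSpectrum_four_five_of_le {n : ℕ} (hn : 19 ≤ n) (hn' : n ≤ 33) :
    n ∈ kgSpectrum 4 5 := by
  -- Every list begins with 4: the chord from 0 to 4 closes the 5-cycle 0, 1, 2, 3, 4.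
  interval_cases n
  · have : IsGirthFiveChordList 19 [4, 11, 8, 16, 6, 12, 9, 15, 0, 13, 10, 16, 2, 18, 11, 15, 1,
      13, 3, 17, 5, 14, 0, 7, 2, 17, 4, 8, 10, 18, 3, 7, 1, 5, 9, 12, 6, 14] := by decide +kernel
    exact this.mem_kgSpectrum (by norm_num)
  · have : IsGirthFiveChordList 20 [4, 7, 10, 14, 8, 16, 11, 18, 0, 9, 12, 16, 14, 18, 0, 11, 2,
      13, 4, 15, 1, 17, 3, 7, 5, 19, 8, 17, 1, 6, 9, 19, 2, 5, 10, 13, 3, 6, 12, 15] := by decide +kernel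
    exact this.mem_kgSpectrum (by norm_num)
  · have : IsGirthFiveChordList 21 [4, 14, 6, 12, 10, 17, 7, 15, 0, 9, 11, 17, 1, 19, 3, 13, 16,
      20, 4, 18, 2, 14, 5, 20, 1, 16, 7, 18, 0, 10, 3, 19, 8, 12, 2, 5, 9, 13, 6, 15, 8, 11] := by
      decide +kernel
    exact this.mem_kgSpectrum (by norm_num)
  · have : IsGirthFiveChordList 22 [4, 16, 9, 18, 6, 20, 11, 17, 0, 14, 10, 18, 2, 13, 15, 19, 17,
      21, 1, 13, 5, 15, 3, 21, 16, 19, 6, 9, 4, 20, 7, 10, 0, 12, 3, 8, 1, 5, 7, 12, 2, 14, 8, 11]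
      := by decide +kernel
    exact this.mem_kgSpectrum (by norm_num)
  · have : IsGirthFiveChordList 23 [4, 11, 9, 18, 7, 15, 12, 20, 0, 14, 10, 18, 13, 16, 2, 22, 14,
      20, 1, 16, 5, 21, 0, 19, 3, 17, 6, 21, 4, 8, 2, 19, 6, 9, 12, 22, 1, 5, 11, 15, 3, 8, 10, 13,
      7, 17] := by decide +kernel
    exact this.mem_kgSpectrum (by norm_num)
  · have : IsGirthFiveChordList 24 [4, 18, 10, 13, 6, 16, 12, 21, 0, 14, 10, 19, 2, 22, 14, 20,
      12, 18, 16, 22, 1, 5, 20, 23, 3, 8, 1, 17, 4, 7, 19, 23, 2, 9, 13, 21, 0, 8, 5, 15, 7, 11, 3,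
      17, 6, 9, 11, 15] := by decide +kernel
    exact this.mem_kgSpectrum (by norm_num)
  · have : IsGirthFiveChordList 25 [4, 12, 14, 20, 8, 22, 13, 16, 0, 21, 10, 14, 19, 23, 12, 17,
      2, 15, 19, 24, 5, 16, 20, 23, 0, 7, 3, 18, 1, 5, 8, 21, 3, 10, 7, 24, 13, 22, 6, 9, 1, 11, 4,
      15, 2, 18, 6, 11, 9, 17] := by decide +kernel
    exact this.mem_kgSpectrum (by norm_num)
  · have : IsGirthFiveChordList 26 [4, 17, 14, 20, 7, 16, 10, 13, 0, 8, 19, 23, 15, 21, 2, 11, 4,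
      24, 16, 22, 3, 19, 7, 17, 21, 25, 3, 23, 1, 18, 6, 25, 2, 9, 0, 11, 14, 22, 5, 10, 1, 24, 6,
      12, 9, 18, 5, 13, 8, 20, 12, 15] := by decide +kernel
    exact this.mem_kgSpectrum (by norm_num)
  · have : IsGirthFiveChordList 27 [4, 16, 7, 22, 15, 20, 13, 18, 0, 9, 11, 17, 14, 26, 1, 24, 15,
      18, 4, 22, 19, 25, 5, 21, 16, 23, 3, 25, 6, 21, 2, 8, 0, 12, 5, 24, 3, 8, 10, 23, 2, 26, 11,
      14, 1, 9, 12, 19, 7, 17, 10, 13, 6, 20] := by decide +kernel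
    exact this.mem_kgSpectrum (by norm_num)
  · have : IsGirthFiveChordList 28 [4, 22, 13, 17, 11, 24, 7, 26, 0, 9, 16, 20, 18, 24, 3, 12, 17,
      21, 4, 25, 20, 27, 2, 22, 7, 16, 1, 25, 18, 21, 23, 27, 5, 12, 1, 8, 6, 14, 23, 26, 5, 10, 8,
      14, 0, 11, 15, 19, 2, 6, 9, 13, 3, 19, 10, 15] := by decide +kernel
    exact this.mem_kgSpectrum (by norm_num)
  · have : IsGirthFiveChordList 29 [4, 21, 15, 18, 6, 25, 14, 22, 0, 24, 9, 18, 2, 16, 11, 26, 15,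
      20, 5, 23, 14, 27, 7, 19, 17, 21, 23, 28, 3, 10, 1, 8, 6, 24, 12, 26, 1, 5, 11, 28, 8, 25, 0,
      12, 3, 27, 9, 13, 4, 16, 2, 20, 7, 17, 10, 22, 13, 19] := by decide +kernel
    exact this.mem_kgSpectrum (by norm_num)
  · have : IsGirthFiveChordList 30 [4, 24, 14, 26, 6, 23, 17, 21, 0, 13, 9, 19, 2, 15, 17, 22, 14,
      20, 5, 16, 22, 29, 15, 27, 21, 25, 4, 28, 1, 8, 6, 11, 9, 25, 3, 7, 24, 28, 5, 26, 8, 29, 3,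
      12, 7, 10, 2, 27, 0, 18, 12, 16, 1, 19, 11, 23, 13, 18, 10, 20] := by decide +kernel
    exact this.mem_kgSpectrum (by norm_num)
  · have : IsGirthFiveChordList 31 [4, 17, 10, 27, 14, 18, 20, 25, 0, 13, 9, 19, 11, 23, 15, 28,
      12, 30, 5, 22, 1, 16, 6, 29, 8, 25, 4, 28, 2, 22, 7, 26, 10, 23, 0, 21, 2, 24, 5, 27, 3, 30,
      17, 26, 9, 14, 6, 16, 18, 29, 3, 12, 15, 21, 1, 19, 7, 13, 11, 24, 8, 20] := by decide +kernel
    exact this.mem_kgSpectrum (by norm_num)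
  · have : IsGirthFiveChordList 32 [4, 22, 14, 19, 10, 27, 21, 25, 0, 13, 9, 19, 14, 22, 16, 30,
      12, 26, 5, 23, 2, 17, 28, 31, 8, 20, 4, 29, 1, 6, 27, 31, 7, 24, 10, 26, 23, 30, 1, 5, 12, 24,
      3, 28, 0, 6, 9, 18, 16, 20, 3, 29, 8, 17, 2, 15, 11, 21, 13, 25, 7, 18, 11, 15] := by decide +kernel
    exact this.mem_kgSpectrum (by norm_num)
  · have : IsGirthFiveChordList 33 [4, 26, 11, 14, 6, 17, 19, 22, 0, 15, 9, 29, 2, 27, 12, 32, 18,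
      26, 5, 24, 17, 32, 1, 29, 7, 21, 18, 30, 1, 23, 4, 20, 24, 27, 2, 10, 8, 13, 3, 31, 15, 28,
      12, 25, 3, 30, 14, 28, 9, 16, 21, 31, 0, 8, 6, 16, 20, 23, 5, 11, 13, 22, 19, 25, 7, 10] := by
      decide +kernel
    exact this.mem_kgSpectrum (by norm_num)

/-! ### Inserting a vertex into two edges. -/

section Insertion

variable {V : Type*} [DecidableEq V]

/-- The table of the graph obtained from that of `nb` by replacing the edges `q 0 - q 1` and
`q 2 - q 3` by a new vertex `none` adjacent to the four vertices `q i`. -/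
def insertTable (nb : V → Fin 4 → V) (q : Fin 4 → V) : Option V → Fin 4 → Option V
  | none, x => some (q x)
  | some v, x =>
    if ∃ i, q i = v ∧ q (![1, 0, 3, 2] i) = nb v x then none else some (nb v x)

variable {nb : V → Fin 4 → V} {q : Fin 4 → V}

theorem insertTable_eq_some {u v : V} {x : Fin 4} : insertTable nb q (some u) x = some v ↔
    nb u x = v ∧ ¬ ∃ i, q i = u ∧ q (![1, 0, 3, 2] i) = v := by
  rw [insertTable]
  split_ifs with h <;> grind

theorem insertTable_eq_none {u : V} {x : Fin 4} : insertTable nb q (some u) x = none ↔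
    ∃ i, q i = u ∧ q (![1, 0, 3, 2] i) = nb u x := by
  rw [insertTable]
  split_ifs with h <;> simp [h]

/-- The involution `![1, 0, 3, 2]` exchanges the ends of each removed edge, so the removal is
symmetric, and each `q i` trades one neighbor for `none`. -/
theorem isNeighborTable_insertTable (h : IsNeighborTable nb) (hq : Function.Injective q)
    (hadj : ∀ i, (tableGraph nb).Adj (q i) (q (![1, 0, 3, 2] i))) :
    IsNeighborTable (insertTable nb q) where
  ne v x hv := by
    cases v with
    | none => simp [insertTable] at hv
    | some v => exact h.ne v x (insertTable_eq_some.1 hv).1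
  symm v x := by
    have hinv (i : Fin 4) : ![1, 0, 3, 2] (![1, 0, 3, 2] i : Fin 4) = i := by
      revert i; decide
    cases v with
    | none =>
      obtain ⟨y, hy⟩ := h.adj.1 (hadj x)
      exact ⟨y, insertTable_eq_none.2 ⟨x, rfl, hy.symm⟩⟩
    | some v =>
      cases hx : insertTable nb q (some v) x with
      | none =>
        obtain ⟨i, rfl, -⟩ := insertTable_eq_none.1 hx
        exact ⟨i, rfl⟩
      | some w =>
        obtain ⟨rfl, hw⟩ := insertTable_eq_some.1 hx
        obtain ⟨y, hy⟩ := h.symm v x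
        refine ⟨y, insertTable_eq_some.2 ⟨hy, ?_⟩⟩
        rintro ⟨i, hi, hi'⟩
        exact hw ⟨_, hi', by rw [hinv, hi]⟩
  inj v x y hxy := by
    cases v with
    | none => exact hq (Option.some.inj hxy)
    | some v =>
      cases hy : insertTable nb q (some v) y with
      | none =>
        obtain ⟨i, rfl, hi⟩ := insertTable_eq_none.1 hy
        obtain ⟨j, hj, hj'⟩ := insertTable_eq_none.1 (hxy.trans hy)
        rw [hq hj, hi] at hj'
        exact (h.inj _ hj').symm
      | some w =>
        have h1 := insertTable_eq_some.1 hy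
        have h2 := insertTable_eq_some.1 (hxy.trans hy)
        exact h.inj v (h2.1.trans h1.1.symm)

/-- Inserting a vertex into two edges at distance at least three keeps the girth equal to five if
some cycle of length five avoids the two edges. -/
theorem isKGGraph_insertTable [Finite V] (h : IsNeighborTable nb)
    (hc : (tableGraph nb).Connected) (hg : 5 ≤ (tableGraph nb).egirth)
    (hq : Function.Injective q)
    (hadj : ∀ i, (tableGraph nb).Adj (q i) (q (![1, 0, 3, 2] i)))
    (hfar : ∀ i j, i ≠ j → j ≠ ![1, 0, 3, 2] i → ¬ (tableGraph nb).Adj (q i) (q j) ∧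
      ∀ v, (tableGraph nb).Adj (q i) v → ¬ (tableGraph nb).Adj v (q j))
    {p : Fin 5 → V} (hp : Function.Injective p)
    (hpadj : ∀ i, (tableGraph nb).Adj (p i) (p (i + 1))) (hpq : ∀ i j, p i ≠ q j) :
    IsKGGraph 4 5 (tableGraph (insertTable nb q)) := by
  have ht := isNeighborTable_insertTable h hq hadj
  have hnone {v : V} : (tableGraph (insertTable nb q)).Adj none (some v) ↔ ∃ i, q i = v := by
    simp [ht.adj, insertTable]
  have hnone' {v : V} : (tableGraph (insertTable nb q)).Adj (some v) none ↔ ∃ i, q i = v := by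
    rw [SimpleGraph.adj_comm, hnone]
  have hsome {u v : V} : (tableGraph (insertTable nb q)).Adj (some u) (some v) ↔
      (tableGraph nb).Adj u v ∧ ¬ ∃ i, q i = u ∧ q (![1, 0, 3, 2] i) = v := by
    rw [ht.adj, h.adj]
    simp only [insertTable_eq_some, exists_and_right]
  have hg3 {a b c : V} (hab : (tableGraph nb).Adj a b) (hbc : (tableGraph nb).Adj b c) :
      ¬ (tableGraph nb).Adj c a :=
    SimpleGraph.not_adj_of_four_le_egirth (le_trans (by norm_num) hg) hab hbc
  -- Excludes 4-cycles through `none`: ends of one edge have no common neighbor by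
  -- triangle-freeness, ends of different edges by their distance.
  have hcommon {i j : Fin 4} {v : V} (hi : (tableGraph nb).Adj (q i) v)
      (hj : (tableGraph nb).Adj v (q j)) : i = j := by
    by_contra hij
    by_cases hj' : j = ![1, 0, 3, 2] i
    · subst hj'
      exact hg3 hi hj (hadj i).symm
    · exact (hfar i j hij hj').2 v hi hj
  -- Excludes triangles through `none`: the only old edges between the `q i` are the removed ones.
  have htri {a b : V} (ha : (tableGraph (insertTable nb q)).Adj none (some a))
      (hab : (tableGraph (insertTable nb q)).Adj (some a) (some b)) :
      ¬ (tableGraph (insertTable nb q)).Adj (some b) none := by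
    intro hb
    obtain ⟨i, rfl⟩ := hnone.1 ha
    obtain ⟨j, rfl⟩ := hnone'.1 hb
    obtain ⟨hij, hcut⟩ := hsome.1 hab
    have hne : i ≠ j := fun h ↦ hij.ne (h ▸ rfl)
    exact (hfar i j hne fun hj ↦ hcut ⟨i, rfl, hj ▸ rfl⟩).1 hij
  refine ht.isKGGraph ?_ (le_antisymm ?_ ?_)
  · have hreach {u v : V} (huv : (tableGraph nb).Adj u v) :
        (tableGraph (insertTable nb q)).Reachable (some u) (some v) := by
      by_cases hcut : ∃ i, q i = u ∧ q (![1, 0, 3, 2] i) = v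
      · obtain ⟨i, rfl, rfl⟩ := hcut
        exact (hnone'.2 ⟨i, rfl⟩).reachable.trans (hnone.2 ⟨_, rfl⟩).reachable
      · exact (hsome.2 ⟨huv, hcut⟩).reachable
    have hall (u v : V) : (tableGraph (insertTable nb q)).Reachable (some u) (some v) := by
      obtain ⟨w⟩ := hc.preconnected u v
      induction w with
      | nil => rfl
      | cons huv _ ih => exact (hreach huv).trans ih
    have h0 (u : Option V) : (tableGraph (insertTable nb q)).Reachable none u := by
      cases u with
      | none => rfl
      | some u => exact (hnone.2 ⟨0, rfl⟩).reachable.trans (hall _ u)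
    exact { preconnected := fun u v ↦ (h0 u).symm.trans (h0 v), nonempty := ⟨none⟩ }
  · refine SimpleGraph.egirth_le_five (p := fun i ↦ some (p i))
      ((Option.some_injective V).comp hp) fun i ↦ hsome.2 ⟨hpadj i, ?_⟩
    rintro ⟨j, hj, -⟩
    exact hpq i j hj.symm
  · refine SimpleGraph.five_le_egirth (fun a b c hab hbc hca ↦ ?_)
      fun a b c d hab hbc hcd hda hac ↦ ?_
    · match a, b, c with
      | some a, some b, some c => exact hg3 (hsome.1 hab).1 (hsome.1 hbc).1 (hsome.1 hca).1
      | none, some b, some c => exact htri hab hbc hca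
      | some a, none, some c => exact htri hbc hca hab
      | some a, some b, none => exact htri hca hab hbc
      | none, none, _ => exact hab.ne rfl
      | _, none, none => exact hbc.ne rfl
      | none, _, none => exact hca.ne rfl
    · match a, b, c, d with
      | some a, some b, some c, some d =>
        rw [SimpleGraph.eq_of_five_le_egirth hg (hsome.1 hab).1 (hsome.1 hbc).1 (hsome.1 hcd).1
          (hsome.1 hda).1 fun h ↦ hac (h ▸ rfl)]
      | none, some b, some c, some d =>
        obtain ⟨i, rfl⟩ := hnone.1 hab
        obtain ⟨j, rfl⟩ := hnone'.1 hda
        rw [hcommon (hsome.1 hbc).1 (hsome.1 hcd).1]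
      | some a, some b, none, some d =>
        obtain ⟨i, rfl⟩ := hnone'.1 hbc
        obtain ⟨j, rfl⟩ := hnone.1 hcd
        rw [hcommon (hsome.1 hab).1.symm (hsome.1 hda).1.symm]
      | some a, none, some c, some d =>
        obtain ⟨i, rfl⟩ := hnone'.1 hab
        obtain ⟨j, rfl⟩ := hnone.1 hbc
        exact absurd (congrArg some (congrArg q (hcommon (hsome.1 hda).1.symm
          (hsome.1 hcd).1.symm))) hac
      | some a, some b, some c, none =>
        obtain ⟨i, rfl⟩ := hnone'.1 hcd
        obtain ⟨j, rfl⟩ := hnone.1 hda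
        exact absurd (congrArg some (congrArg q (hcommon (hsome.1 hbc).1.symm
          (hsome.1 hab).1.symm))) hac.symm
      | _, none, _, none => rfl
      | none, _, none, _ => exact absurd rfl hac
      | none, none, _, _ => exact absurd rfl hab.ne
      | _, none, none, _ => exact absurd rfl hbc.ne
      | _, _, none, none => exact absurd rfl hcd.ne
      | none, _, _, none => exact absurd rfl hda.ne

end Insertion

/-! ### Girth 5, orders from 34 on. -/

section Bicirculant

/-- The differences between the first coordinates of a vertex with the second coordinate `s` and
its four neighbors in the bicirculant graph. -/
def bicirculantJump (s : Bool) : Fin 4 → ℤ := if s then ![4, -4, 0, 1] else ![2, -2, 0, -1]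

/-- Two of the neighbors have the second coordinate `s`, two the other one. -/
def bicirculantSide (s : Bool) : Fin 4 → Bool := ![s, s, !s, !s]

/-- The table of a graph that consists of the circulant graphs `C_m(2)` and `C_m(4)` and a cycle of
length `2 m` joining them. -/
def bicirculantTable (m : ℕ) (v : ZMod m × Bool) (x : Fin 4) : ZMod m × Bool :=
  (v.1 + bicirculantJump v.2 x, bicirculantSide v.2 x)

variable {m : ℕ}

theorem isNeighborTable_bicirculantTable (hm : 17 ≤ m) :
    IsNeighborTable (bicirculantTable m) where
  ne := by
    rintro ⟨i, s⟩ x h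
    simp only [bicirculantTable, Prod.mk.injEq, add_eq_left] at h
    have := (by decide : ∀ s x, bicirculantSide s x = s →
      |bicirculantJump s x| < 17 ∧ bicirculantJump s x ≠ 0) s x h.2
    exact this.2 ((ZMod.intCast_eq_zero_iff_of_abs_lt (by lia)).1 h.1)
  symm := by
    rintro ⟨i, s⟩ x
    obtain ⟨y, hy, hy'⟩ := (by decide : ∀ s x, ∃ y, bicirculantSide (bicirculantSide s x) y = s ∧
      bicirculantJump (bicirculantSide s x) y = - bicirculantJump s x) s x
    exact ⟨y, by simp [bicirculantTable, hy, hy']⟩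
  inj := by
    rintro ⟨i, s⟩ x y h
    simp only [bicirculantTable, Prod.mk.injEq, add_right_inj] at h
    have := (by decide : ∀ s x y, bicirculantSide s x = bicirculantSide s y →
      |bicirculantJump s x - bicirculantJump s y| < 17 ∧
      (bicirculantJump s x - bicirculantJump s y = 0 → x = y)) s x y h.2
    refine this.2 ((ZMod.intCast_eq_zero_iff_of_abs_lt (n := m) (by lia)).1 ?_)
    rw [Int.cast_sub, h.1, sub_self]

theorem connected_bicirculantTable (hm : 17 ≤ m) : (tableGraph (bicirculantTable m)).Connected := by
  have : NeZero m := ⟨by lia⟩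
  have ht := isNeighborTable_bicirculantTable hm
  have h1 (i : ZMod m) : (tableGraph (bicirculantTable m)).Adj (i, false) (i, true) :=
    ht.adj.2 ⟨2, by simp [bicirculantTable, bicirculantJump, bicirculantSide]⟩
  have h2 (i : ZMod m) : (tableGraph (bicirculantTable m)).Adj (i, true) (i + 1, false) :=
    ht.adj.2 ⟨3, by simp [bicirculantTable, bicirculantJump, bicirculantSide]⟩
  have h0 (k : ℕ) :
      (tableGraph (bicirculantTable m)).Reachable (0, false) ((k : ZMod m), false) := by
    induction k with
    | zero => simp
    | succ k ih =>
      push_cast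
      exact ih.trans ((h1 k).reachable.trans (h2 k).reachable)
  have h0' (v : ZMod m × Bool) : (tableGraph (bicirculantTable m)).Reachable (0, false) v := by
    obtain ⟨i, s⟩ := v
    have hi := h0 i.val
    rw [ZMod.natCast_zmod_val] at hi
    cases s with
    | false => exact hi
    | true => exact hi.trans (h1 i).reachable
  exact { preconnected := fun u v ↦ (h0' u).symm.trans (h0' v), nonempty := ⟨(0, false)⟩ }

/-- Jumps are at most 4 in absolute value, so comparing two walks of length 2 involves shifts of at
most 16. This is why m ≥ 17 reduces everything to ℤ. -/
theorem five_le_egirth_bicirculantTable (hm : 17 ≤ m) :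
    5 ≤ (tableGraph (bicirculantTable m)).egirth := by
  refine (isNeighborTable_bicirculantTable hm).five_le_egirth ?_ ?_
  · rintro ⟨i, s⟩ x y z h
    simp only [bicirculantTable, Prod.mk.injEq, add_assoc, add_eq_left] at h
    have := (by decide : ∀ s x y z, bicirculantSide (bicirculantSide (bicirculantSide s x) y) z = s →
      |bicirculantJump s x + (bicirculantJump (bicirculantSide s x) y +
        bicirculantJump (bicirculantSide (bicirculantSide s x) y) z)| < 17 ∧
      bicirculantJump s x + (bicirculantJump (bicirculantSide s x) y +
        bicirculantJump (bicirculantSide (bicirculantSide s x) y) z) ≠ 0) s x y z h.2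
    refine this.2 ((ZMod.intCast_eq_zero_iff_of_abs_lt (n := m) (by lia)).1 ?_)
    exact_mod_cast h.1
  · rintro ⟨i, s⟩ x y z w h hne
    simp only [bicirculantTable, Prod.mk.injEq, add_assoc, add_right_inj, ne_eq,
      add_eq_left] at h hne
    have := (by decide +kernel : ∀ s x y z w, bicirculantSide (bicirculantSide s x) y =
        bicirculantSide (bicirculantSide s z) w →
      |bicirculantJump s x + bicirculantJump (bicirculantSide s x) y -
        (bicirculantJump s z + bicirculantJump (bicirculantSide s z) w)| < 17 ∧
      (bicirculantJump s x + bicirculantJump (bicirculantSide s x) y -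
        (bicirculantJump s z + bicirculantJump (bicirculantSide s z) w) = 0 →
      -- The second alternative is a walk that returns to its start, which `hne` rules out.
      x = z ∨ bicirculantJump s x + bicirculantJump (bicirculantSide s x) y = 0 ∧
        bicirculantSide (bicirculantSide s x) y = s)) s x y z w h.2
    refine (this.2 ((ZMod.intCast_eq_zero_iff_of_abs_lt (n := m) (by lia)).1 ?_)).resolve_right
      fun h' ↦ hne ⟨?_, h'.2⟩
    · push_cast
      rw [h.1, sub_self]
    · rw [← Int.cast_add, h'.1, Int.cast_zero]

/-- The five vertices of a cycle. -/
def bicirculantCycle (m : ℕ) (i : Fin 5) : ZMod m × Bool :=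
  ((![1, 1, 2, 2, 3] i : ℤ), ![false, true, false, true, false] i)

/-- The ends of two edges at distance at least three that avoid the cycle. -/
def bicirculantEnds (m : ℕ) (i : Fin 4) : ZMod m × Bool :=
  ((![0, 0, 6, 6] i : ℤ), ![false, true, false, true] i)

theorem intCast_pair_eq_iff (hm : 17 ≤ m) {a b : ℤ} {s t : Bool} (h : |a - b| < 17) :
    ((a : ZMod m), s) = ((b : ZMod m), t) ↔ a = b ∧ s = t := by
  rw [Prod.mk.injEq, ← sub_eq_zero, ← Int.cast_sub,
    ZMod.intCast_eq_zero_iff_of_abs_lt (by lia), sub_eq_zero]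

/-- The margin 13 = 17 - 4 leaves room for one more jump. -/
theorem bicirculant_adj_iff (hm : 17 ≤ m) {a b : ℤ} {s t : Bool} (h : |a - b| < 13) :
    (tableGraph (bicirculantTable m)).Adj (a, s) (b, t) ↔
      ∃ x, a + bicirculantJump s x = b ∧ bicirculantSide s x = t := by
  rw [(isNeighborTable_bicirculantTable hm).adj]
  refine exists_congr fun x ↦ ?_
  have := (by decide : ∀ s x, |bicirculantJump s x| ≤ 4) s x
  rw [abs_lt] at h
  rw [abs_le] at this
  rw [← intCast_pair_eq_iff hm (by rw [abs_lt]; lia), bicirculantTable, Int.cast_add]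

theorem bicirculantCycle_adj (hm : 17 ≤ m) (i : Fin 5) : (tableGraph (bicirculantTable m)).Adj
    (bicirculantCycle m i) (bicirculantCycle m (i + 1)) := by
  have h := (by decide : ∀ i : Fin 5, |(![1, 1, 2, 2, 3] i - ![1, 1, 2, 2, 3] (i + 1) : ℤ)| < 13 ∧
    ∃ x, ![1, 1, 2, 2, 3] i + bicirculantJump (![false, true, false, true, false] i) x =
        ![1, 1, 2, 2, 3] (i + 1) ∧
      bicirculantSide (![false, true, false, true, false] i) x =
        ![false, true, false, true, false] (i + 1)) i
  exact (bicirculant_adj_iff hm h.1).2 h.2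

theorem bicirculantCycle_injective (hm : 17 ≤ m) : Function.Injective (bicirculantCycle m) := by
  intro i j h
  have := (by decide : ∀ i j : Fin 5, |(![1, 1, 2, 2, 3] i - ![1, 1, 2, 2, 3] j : ℤ)| < 17 ∧
    ((![1, 1, 2, 2, 3] i : ℤ) = ![1, 1, 2, 2, 3] j ∧ ![false, true, false, true, false] i =
      ![false, true, false, true, false] j → i = j)) i j
  exact this.2 ((intCast_pair_eq_iff hm this.1).1 h)

theorem isKGGraph_bicirculantTable (hm : 17 ≤ m) :
    IsKGGraph 4 5 (tableGraph (bicirculantTable m)) := by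
  have : NeZero m := ⟨by lia⟩
  exact (isNeighborTable_bicirculantTable hm).isKGGraph (connected_bicirculantTable hm)
    (le_antisymm (SimpleGraph.egirth_le_five (bicirculantCycle_injective hm)
      (bicirculantCycle_adj hm)) (five_le_egirth_bicirculantTable hm))

theorem isKGGraph_insertTable_bicirculantTable (hm : 17 ≤ m) :
    IsKGGraph 4 5 (tableGraph (insertTable (bicirculantTable m) (bicirculantEnds m))) := by
  have : NeZero m := ⟨by lia⟩
  have ht := isNeighborTable_bicirculantTable hm
  refine isKGGraph_insertTable ht (connected_bicirculantTable hm)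
    (five_le_egirth_bicirculantTable hm) (fun i j h ↦ ?_) (fun i ↦ ?_)
    (fun i j hij hij' ↦ ⟨fun h ↦ ?_, fun v hv h ↦ ?_⟩) (bicirculantCycle_injective hm)
    (bicirculantCycle_adj hm) fun i j h ↦ ?_
  · have := (by decide : ∀ i j : Fin 4, |(![0, 0, 6, 6] i - ![0, 0, 6, 6] j : ℤ)| < 17 ∧
      ((![0, 0, 6, 6] i : ℤ) = ![0, 0, 6, 6] j ∧ ![false, true, false, true] i =
        ![false, true, false, true] j → i = j)) i j
    exact this.2 ((intCast_pair_eq_iff hm this.1).1 h)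
  · have h := (by decide : ∀ i : Fin 4,
      |(![0, 0, 6, 6] i - ![0, 0, 6, 6] (![1, 0, 3, 2] i : Fin 4) : ℤ)| < 13 ∧
      ∃ x, ![0, 0, 6, 6] i + bicirculantJump (![false, true, false, true] i) x =
          ![0, 0, 6, 6] (![1, 0, 3, 2] i : Fin 4) ∧
        bicirculantSide (![false, true, false, true] i) x =
          ![false, true, false, true] (![1, 0, 3, 2] i : Fin 4)) i
    exact (bicirculant_adj_iff hm h.1).2 h.2
  · have h' := (by decide : ∀ i j : Fin 4, i ≠ j → j ≠ ![1, 0, 3, 2] i →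
      |(![0, 0, 6, 6] i - ![0, 0, 6, 6] j : ℤ)| < 13 ∧
      ¬ ∃ x, ![0, 0, 6, 6] i + bicirculantJump (![false, true, false, true] i) x =
          ![0, 0, 6, 6] j ∧
        bicirculantSide (![false, true, false, true] i) x = ![false, true, false, true] j)
      i j hij hij'
    exact h'.2 ((bicirculant_adj_iff hm h'.1).1 h)
  · obtain ⟨x, rfl⟩ := ht.adj.1 hv
    have h' := (by decide : ∀ i j : Fin 4, i ≠ j → j ≠ ![1, 0, 3, 2] i → ∀ x,
      |(![0, 0, 6, 6] i + bicirculantJump (![false, true, false, true] i) x -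
        ![0, 0, 6, 6] j : ℤ)| < 13 ∧
      ¬ ∃ y, ![0, 0, 6, 6] i + bicirculantJump (![false, true, false, true] i) x +
          bicirculantJump (bicirculantSide (![false, true, false, true] i) x) y =
          ![0, 0, 6, 6] j ∧
        bicirculantSide (bicirculantSide (![false, true, false, true] i) x) y =
          ![false, true, false, true] j) i j hij hij' x
    refine h'.2 ((bicirculant_adj_iff hm h'.1).1 ?_)
    rw [Int.cast_add]
    exact h
  · have := (by decide : ∀ (i : Fin 5) (j : Fin 4),
      |(![1, 1, 2, 2, 3] i - ![0, 0, 6, 6] j : ℤ)| < 17 ∧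
      ¬ ((![1, 1, 2, 2, 3] i : ℤ) = ![0, 0, 6, 6] j ∧ ![false, true, false, true, false] i =
        ![false, true, false, true] j)) i j
    exact this.2 ((intCast_pair_eq_iff hm this.1).1 h)

theorem mem_kgSpectrum_four_five {n : ℕ} (hn : 19 ≤ n) : n ∈ kgSpectrum 4 5 := by
  obtain h | h := le_or_gt n 33
  · exact mem_kgSpectrum_four_five_of_le hn h
  obtain ⟨m, rfl | rfl⟩ := n.even_or_odd'
  · refine (isKGGraph_bicirculantTable (m := m) (by lia)).card_mem_kgSpectrum ?_
    simp [mul_comm]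
  · refine (isKGGraph_insertTable_bicirculantTable (m := m) (by lia)).card_mem_kgSpectrum ?_
    have : NeZero m := ⟨by lia⟩
    simp [mul_comm]

end Bicirculant

/-! ### The three spectra. -/

theorem kgSpectrum_four_three : kgSpectrum 4 3 = {n | 5 ≤ n} :=
  Set.ext fun _ ↦ ⟨five_le_of_mem_kgSpectrum_four, mem_kgSpectrum_four_three⟩

theorem kgSpectrum_four_four : kgSpectrum 4 4 = {8} ∪ {n | 10 ≤ n} := by
  ext n
  simp only [Set.mem_union, Set.mem_singleton_iff, Set.mem_ofPred_eq]
  refine ⟨fun h ↦ ?_, fun h ↦ ?_⟩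
  · have := eight_le_and_ne_nine_of_mem_kgSpectrum_four_four h
    lia
  · exact (isKGGraph_circulantOneThree (by lia) (by lia)).card_mem_kgSpectrum (Nat.card_zmod n)

theorem kgSpectrum_four_five : kgSpectrum 4 5 = {n | 19 ≤ n} :=
  Set.ext fun _ ↦ ⟨nineteen_le_of_mem_kgSpectrum_four_five, mem_kgSpectrum_four_five⟩

theorem isKGGraph_top_five : IsKGGraph 4 3 (⊤ : SimpleGraph (Fin 5)) where
  finite := inferInstance
  connected := SimpleGraph.connected_top
  regular := ⟨fun _ ↦ inferInstance, by simpa using SimpleGraph.IsRegularOfDegree.top (V := Fin 5)⟩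
  egirth_eq := SimpleGraph.egirth_top (by simpa using (by norm_num : (3 : ℕ∞) ≤ 5))

theorem mainTheorem5 :
    -- the (4,3)-spectrum, which starts with the order of the complete graph on 5 vertices
    (kgSpectrum 4 3 = {n | 5 ≤ n} ∧
      cageOrder 4 3 = 5 ∧
      IsKGGraph 4 3 (⊤ : SimpleGraph (Fin 5))) ∧
    -- the (4,4)-spectrum, its hole at 9, and its realization by circulant graphs
    (kgSpectrum 4 4 = {8} ∪ {n | 10 ≤ n} ∧
      9 ∉ kgSpectrum 4 4 ∧
      (∀ n ∈ kgSpectrum 4 4, IsKGGraph 4 4 (circulantOneThree n)) ∧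
      (circulantOneThree 9).egirth = 3 ∧
      cageOrder 4 4 = 8 ∧
      fullOrder 4 4 = 10) ∧
    -- the (4,5)-spectrum
    (kgSpectrum 4 5 = {n | 19 ≤ n} ∧
      cageOrder 4 5 = 19 ∧
      fullOrder 4 5 = cageOrder 4 5) := by
  have h9 : 9 ∉ kgSpectrum 4 4 := fun h ↦
    (eight_le_and_ne_nine_of_mem_kgSpectrum_four_four h).2 rfl
  have h45 : cageOrder 4 5 = 19 := by
    rw [cageOrder, kgSpectrum_four_five]
    exact IsLeast.csInf_eq ⟨le_refl 19, fun _ h ↦ h⟩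
  refine ⟨⟨kgSpectrum_four_three, ?_, isKGGraph_top_five⟩,
    ⟨kgSpectrum_four_four, h9, fun n hn ↦ ?_, egirth_circulantOneThree_nine, ?_, ?_⟩,
    kgSpectrum_four_five, h45, ?_⟩
  · rw [cageOrder, kgSpectrum_four_three]
    exact IsLeast.csInf_eq ⟨le_refl 5, fun _ h ↦ h⟩
  · obtain ⟨h8, hne⟩ := eight_le_and_ne_nine_of_mem_kgSpectrum_four_four hn
    exact isKGGraph_circulantOneThree h8 hne
  · rw [cageOrder, kgSpectrum_four_four]
    refine IsLeast.csInf_eq ⟨.inl rfl, ?_⟩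
    rintro n (rfl | h)
    · exact le_rfl
    · exact le_trans (by norm_num) h
  · have hodd : ¬ Odd 4 := by decide
    refine IsLeast.csInf_eq ⟨⟨fun h ↦ absurd h hodd, fun n hn _ ↦ ?_⟩, fun N hN ↦ ?_⟩
    · rw [kgSpectrum_four_four]
      exact .inr hn
    -- A threshold below 10 would put the missing order 9 into the spectrum.
    · by_contra! hlt
      exact h9 (hN.2 9 (by lia) fun h ↦ absurd h hodd)
  · have hodd : ¬ Odd 4 := by decide
    rw [h45]
    -- A threshold `N` is itself an order in the spectrum, hence at least 19.
    refine IsLeast.csInf_eq ⟨⟨fun h ↦ absurd h hodd, fun n hn _ ↦ mem_kgSpectrum_four_five hn⟩,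
      fun N hN ↦ nineteen_le_of_mem_kgSpectrum_four_five
        (hN.2 N le_rfl fun h ↦ absurd h hodd)⟩
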